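/- Let $D$ be an integral domain with quotient field $K$. For a domain $A$ with quotient field $F$ and $S\subseteq A$ put $\mathrm{Int}(S,A)=\{f\in F[X] : f(S)\subseteq A\}$. Let $\mathfrak p$ be a prime ideal of $D$ that is divided, i.e. $\mathfrak p=\mathfrak pD_{\mathfrak p}$, and whose residue field $D_{\mathfrak p}/\mathfrak pD_{\mathfrak p}$ is infinite. Let $E$ be a nonempty subset of $D$, and for a prime $\mathfrak q$ of $D$ let $E/\mathfrak q\subseteq D/\mathfrak q$ denote the set of residue classes of the elements of $E$ modulo $\mathfrak q$. Assume that one of the following holds: (a) $E$ meets infinitely many cosets of $\mathfrak p$, i.e. $E/\mathfrak p$ is infinite; (b) $E$ is an ideal of $D$ containing $\mathfrak p$, and $E\neq\mathfrak p$ if $\mathfrak p\neq 0$; (c) $E$ is residually cofinite with $D$, i.e. for each prime ideal $\mathfrak q$ of $D$, if $E/\mathfrak q$ is finite then $D/\mathfrak q$ is finite. Then the Krull dimensions satisfy $$\dim(\mathrm{Int}(E,D))=\dim(D_{\mathfrak p}[X])+\dim(\mathrm{Int}(E/\mathfrak p,D/\mathfrak p))-1$$ (where $\infty-1=\infty$).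 Moreover, if $\mathfrak p$ is maximal, then $\dim(\mathrm{Int}(E,D))=\dim(D_{\mathfrak p}[X])$, and hence $\dim(\mathrm{Int}(E,D))\leqslant\dim(D[X])$. -/

import Mathlib

open Polynomial

/-- The ring `Int(E, D) = {f ∈ K[X] : f(E) ⊆ D}` of integer-valued polynomials on a subset `E`
of `K`, where `K` is (in all uses) the quotient field of the domain `D`. -/
def integerValued (D : Type*) {K : Type*} [CommRing D] [Field K] [Algebra D K] (E : Set K) :
    Subalgebra D K[X] where
  carrier := {f | ∀ a ∈ E, f.eval a ∈ (algebraMap D K).range}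
  mul_mem' := by
    intro f g hf hg a ha
    rw [eval_mul]
    exact mul_mem (hf a ha) (hg a ha)
  add_mem' := by
    intro f g hf hg a ha
    rw [eval_add]
    exact add_mem (hf a ha) (hg a ha)
  algebraMap_mem' := by
    intro d a _
    rw [Polynomial.algebraMap_apply, eval_C]
    exact ⟨d, rfl⟩

/-- A prime ideal `p` of `D` is divided if `p = p D_p`, as subsets of the localization `D_p`. -/
def IsDividedPrime {D : Type*} [CommRing D] (p : Ideal D) [p.IsPrime] : Prop :=
  (algebraMap D (Localization.AtPrime p)) '' (p : Set D) =
    (p.map (algebraMap D (Localization.AtPrime p)) : Set (Localization.AtPrime p))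

/-- `E / p`, the set of the residue classes modulo `p` of the elements of `E`. -/
def residues {D : Type*} [CommRing D] (p : Ideal D) (E : Set D) : Set (D ⧸ p) :=
  Ideal.Quotient.mk p '' E

/-- A (nonempty) subset `E` of `D` is residually cofinite with `D` if, for each prime ideal `q`
of `D`, finiteness of `E / q` implies finiteness of `D / q`. -/
def IsResiduallyCofinite {D : Type*} [CommRing D] (E : Set D) : Prop :=
  ∀ q : Ideal D, q.IsPrime → (residues q E).Finite → Finite (D ⧸ q)

/-! Write `V` for `D_p`, `m` for its maximal ideal, `L` for its residue field and `A` for `Int(E,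
D)`. As `p` is divided, `D` is the preimage of `D / p` under `V → L`. Lagrange interpolation (or `V
= K`, if `p = 0`) gives `A ⊆ V[X]`, so `A` is the preimage of `Int(E / p, D / p)` under `V[X] →
L[X]`, whose kernel is `m[X]`. Since `V[X]` is a localization of `A`, `m[X] ∩ A` has the height of
`m[X]`, and no prime of `A` outside `V(m[X] ∩ A)` has larger height. Hence `dim A = ht m[X] + dim
Int(E / p, D / p)`, while `dim V[X] = ht m[X] + 1`. -/

/-! ### Heights of primes in polynomial rings -/

lemma comap_C_map_C {R : Type*} [CommRing R] (I : Ideal R) :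
    (I.map (C : R →+* R[X])).comap C = I := by
  ext r
  rw [Ideal.mem_comap, Ideal.mem_map_C_iff]
  refine ⟨fun h ↦ by simpa using h 0, fun h n ↦ ?_⟩
  rw [coeff_C]
  split_ifs
  exacts [h, I.zero_mem]

/-- In a proper inclusion of primes of `R[X]` with the same contraction `q` to `R`, the smaller one
is `q[X]`. -/
lemma eq_map_C_comap_of_lt {R : Type*} [CommRing R] {P Q : Ideal R[X]} [P.IsPrime] [Q.IsPrime]
    (hlt : P < Q) (h : P.comap C = Q.comap C) : P = (Q.comap C).map C := by
  have hq : (Q.comap C).IsPrime := Ideal.comap_isPrime C Q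
  -- The fibre over `q` is the spectrum of `κ(q)[X]`, so each of its points is minimal or maximal.
  have hdim : Order.krullDim
      (PrimeSpectrum.comap (C : R →+* R[X]) ⁻¹' {⟨Q.comap C, hq⟩}) ≤ 1 := by
    refine (Order.krullDim_eq_of_orderIso
      (PrimeSpectrum.preimageOrderIsoFiber R R[X] ⟨Q.comap C, hq⟩)).trans_le ?_
    rw [← ringKrullDim, ← ringKrullDim_eq_of_ringEquiv
        (polyEquivTensor R ((Q.comap C).ResidueField)).toRingEquiv,
      ← Nat.cast_one, ← Ring.krullDimLE_iff]
    infer_instance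
  let x : PrimeSpectrum.comap (C : R →+* R[X]) ⁻¹' {⟨Q.comap C, hq⟩} :=
    ⟨⟨P, ‹_›⟩, PrimeSpectrum.ext h⟩
  let y : PrimeSpectrum.comap (C : R →+* R[X]) ⁻¹' {⟨Q.comap C, hq⟩} :=
    ⟨⟨Q, ‹_›⟩, rfl⟩
  let z : PrimeSpectrum.comap (C : R →+* R[X]) ⁻¹' {⟨Q.comap C, hq⟩} :=
    ⟨⟨(Q.comap C).map C, Ideal.isPrime_map_C_of_isPrime⟩, PrimeSpectrum.ext (comap_C_map_C _)⟩
  have hzx : z ≤ x := show (Q.comap C).map C ≤ P from h ▸ Ideal.map_comap_le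
  rcases Order.krullDim_le_one_iff.mp hdim x with hx | hx
  · exact le_antisymm (show x ≤ z from hx hzx) hzx
  · exact absurd (hx (show x ≤ y from hlt.le)) (not_le_of_gt hlt)

/-- The height of a prime `Q` of `R[X]` exceeds that of `(Q ∩ R)[X]` by at most one. -/
lemma height_le_height_map_C_comap_add_one {R : Type*} [CommRing R] (Q : Ideal R[X]) [Q.IsPrime] :
    Q.height ≤ ((Q.comap C).map C).height + 1 := by
  -- Heights may be infinite, so the induction runs over finite lower bounds of the height.
  refine ENat.forall_natCast_le_iff_le.mp fun n ↦ ?_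
  induction n generalizing Q with
  | zero => simp
  | succ n ih =>
    intro hn
    obtain ⟨P, hP, hlt, hnP⟩ : ∃ P : Ideal R[X], P.IsPrime ∧ P < Q ∧ n ≤ P.height := by
      by_contra! H
      have := hn.trans (Ideal.height_le_iff.mpr H)
      norm_cast at this
      omega
    rw [Nat.cast_succ]
    gcongr
    by_cases h : P.comap C = Q.comap C
    · rwa [← eq_map_C_comap_of_lt hlt h]
    · have hlt' : P.comap C < Q.comap C := lt_of_le_of_ne (Ideal.comap_mono hlt.le) h
      have hp : (P.comap C).IsPrime := Ideal.comap_isPrime C P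
      have hq : (Q.comap C).IsPrime := Ideal.comap_isPrime C Q
      have := Ideal.isPrime_map_C_of_isPrime (P := P.comap C)
      have := Ideal.isPrime_map_C_of_isPrime (P := Q.comap C)
      refine (ih P hnP).trans (Ideal.height_add_one_le_of_lt_of_isPrime
        (lt_of_le_of_ne (Ideal.map_mono hlt'.le) fun he ↦ h ?_))
      rw [← comap_C_map_C (P.comap C), he, comap_C_map_C]

lemma ringKrullDim_le_of_isLocalization {R : Type*} [CommRing R] (M : Submonoid R) (S : Type*)
    [CommRing S] [Algebra R S] [IsLocalization M S] : ringKrullDim S ≤ ringKrullDim R := by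
  rw [ringKrullDim_le_iff_height_le]
  intro Q hQ
  rw [← IsLocalization.height_under M Q]
  exact Ideal.height_le_ringKrullDim_of_ne_top (Ideal.IsPrime.under R Q).ne_top

/-- The dimension of the polynomial ring over a local ring. -/
lemma ringKrullDim_polynomial_of_isLocalRing {R : Type*} [CommRing R] [IsLocalRing R] :
    ringKrullDim R[X] = ((IsLocalRing.maximalIdeal R).map C : Ideal R[X]).height + 1 := by
  have hm := Ideal.isPrime_map_C_of_isPrime (P := IsLocalRing.maximalIdeal R)
  apply le_antisymm
  · rw [ringKrullDim_le_iff_height_le]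
    intro Q hQ
    have hq : (Q.comap C).IsPrime := Ideal.comap_isPrime C Q
    have := (height_le_height_map_C_comap_add_one Q).trans (add_le_add_left
      (Ideal.height_mono (Ideal.map_mono (IsLocalRing.le_maximalIdeal hq.ne_top))) 1)
    exact_mod_cast this
  · obtain ⟨M, hM, hle⟩ := Ideal.exists_le_maximal _ hm.ne_top
    have hlt : (IsLocalRing.maximalIdeal R).map C < M := by
      refine lt_of_le_of_ne hle fun he ↦ ?_
      rw [← he] at hM
      have hfield := (Ideal.Quotient.maximal_ideal_iff_isField_quotient _).mp hM
      have e := Ideal.polynomialQuotientEquivQuotientPolynomial (IsLocalRing.maximalIdeal R)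
      exact Polynomial.not_isField (R ⧸ IsLocalRing.maximalIdeal R)
        (e.toMulEquiv.isField hfield)
    have := (Ideal.height_add_one_le_of_lt_of_isPrime hlt)
    refine le_trans ?_ (Ideal.height_le_ringKrullDim_of_isPrime (I := M))
    exact_mod_cast this

/-- Descend a chain from `Q`: links containing `P` count in `Set.Ici P`. Once the chain leaves it,
`H` bounds the rest by the height of `P`, and the leaving step is paid for by `P < Q`. -/
lemma height_le_height_add_height_Ici {A : Type*} [CommRing A] (P : Ideal A) [P.IsPrime]
    (H : ∀ Q : Ideal A, Q.IsPrime → ¬ P ≤ Q → Q.height ≤ P.height) (Q : Ideal A) [Q.IsPrime]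
    (h : P ≤ Q) :
    Q.height ≤ P.height + Order.height (α := Set.Ici (⟨P, ‹_›⟩ : PrimeSpectrum A))
      ⟨⟨Q, ‹_›⟩, h⟩ := by
  refine ENat.forall_natCast_le_iff_le.mp fun n ↦ ?_
  induction n generalizing Q with
  | zero => simp
  | succ n ih =>
    intro hn
    obtain ⟨Q', hQ', hlt, hnQ'⟩ : ∃ Q' : Ideal A, Q'.IsPrime ∧ Q' < Q ∧ n ≤ Q'.height := by
      by_contra! H
      have := hn.trans (Ideal.height_le_iff.mpr H)
      norm_cast at this
      omega
    rcases eq_or_lt_of_le h with rfl | hPQ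
    · exact hn.trans le_self_add
    by_cases h' : P ≤ Q'
    · have hlt' : (⟨⟨Q', hQ'⟩, h'⟩ : Set.Ici (⟨P, ‹_›⟩ : PrimeSpectrum A)) < ⟨⟨Q, ‹_›⟩, h⟩ := hlt
      rw [Nat.cast_succ]
      refine (add_le_add_left (ih Q' h' hnQ') 1).trans ?_
      rw [add_assoc]
      gcongr
      exact Order.height_add_one_le hlt'
    · have hlt' : (⟨⟨P, ‹_›⟩, Set.self_mem_Ici⟩ : Set.Ici (⟨P, ‹_›⟩ : PrimeSpectrum A)) < ⟨⟨Q, ‹_›⟩, h⟩ :=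
        hPQ
      rw [Nat.cast_succ]
      refine add_le_add (hnQ'.trans (H Q' hQ' h')) ?_
      exact le_add_self.trans (Order.height_add_one_le hlt')

/-- If no prime outside `V(P)` has height larger than `P`, then `dim A = ht P + dim A / P`. -/
lemma ringKrullDim_eq_height_add_ringKrullDim_quotient {A : Type*} [CommRing A] (P : Ideal A)
    [P.IsPrime] (H : ∀ Q : Ideal A, Q.IsPrime → ¬ P ≤ Q → Q.height ≤ P.height) :
    ringKrullDim A = P.height + ringKrullDim (A ⧸ P) := by
  have hquot : ringKrullDim (A ⧸ P) = Order.krullDim (Set.Ici (⟨P, ‹_›⟩ : PrimeSpectrum A)) := by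
    rw [ringKrullDim_quotient]
    rfl
  rw [hquot]
  apply le_antisymm
  · rw [ringKrullDim_le_iff_height_le]
    intro Q hQ
    by_cases h : P ≤ Q
    · refine le_trans (WithBot.coe_le_coe.mpr (height_le_height_add_height_Ici P H Q h)) ?_
      rw [WithBot.coe_add]
      gcongr
      exact Order.height_le_krullDim _
    · refine (WithBot.coe_le_coe.mpr (H Q hQ h)).trans ?_
      rw [← Order.coheight_eq_krullDim_Ici]
      exact_mod_cast le_self_add
  · have : Nonempty (PrimeSpectrum A) := ⟨⟨P, ‹_›⟩⟩
    rw [← Order.coheight_eq_krullDim_Ici, ringKrullDim,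
      Order.krullDim_eq_iSup_height_add_coheight_of_nonempty]
    have := le_iSup (fun a : PrimeSpectrum A ↦ Order.height a + Order.coheight a) ⟨P, ‹_›⟩
    rw [← PrimeSpectrum.height_eq_orderHeight] at this
    exact_mod_cast this

/-! ### The pullback formula for the dimension -/

lemma exists_ringHom_factor {A B C : Type*} [CommRing A] [CommRing B] [CommRing C] (i : B →+* C)
    (hi : Function.Injective i) (j : A →+* C) (h : ∀ a, ∃ b, i b = j a) :
    ∃ ψ : A →+* B, ∀ a, i (ψ a) = j a := by
  choose f hf using h
  exact ⟨{ toFun := f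
           map_one' := hi (by simp [hf])
           map_mul' := fun a b ↦ hi (by simp [hf])
           map_zero' := hi (by simp [hf])
           map_add' := fun a b ↦ hi (by simp [hf]) }, hf⟩

/-- The dimension of `Int(E, D)` when `D` is the pullback of a subring `R` of the residue field `L`
of a localization `V` of `D`, provided that `Int(E, D) ⊆ V[X]`. -/
theorem ringKrullDim_integerValued_of_pullback {D V K R L : Type*} [CommRing D] [CommRing V]
    [IsLocalRing V] [Field K] [CommRing R] [Field L] [Algebra D V] [Algebra D K] [Algebra R L]
    (M : Submonoid D) [IsLocalization M V]
    (ι : V →+* K) (hι : Function.Injective ι) (hιD : ∀ d, ι (algebraMap D V d) = algebraMap D K d)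
    (π : D →+* R) (ρ : V →+* L) (hρ : Function.Surjective ρ)
    (hρD : ∀ d, ρ (algebraMap D V d) = algebraMap R L (π d))
    (hpull : ∀ v, ρ v ∈ (algebraMap R L).range → v ∈ (algebraMap D V).range)
    (E : Set D)
    (hsub : ∀ f ∈ integerValued D (algebraMap D K '' E), ∃ g : V[X], g.map ι = f) :
    ringKrullDim (integerValued D (algebraMap D K '' E)) =
      ((IsLocalRing.maximalIdeal V).map C : Ideal V[X]).height +
        ringKrullDim (integerValued R (algebraMap R L '' (π '' E))) := by
  set A := integerValued D (algebraMap D K '' E) with hA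
  have hιX : Function.Injective (mapRingHom ι) := Polynomial.map_injective ι hι
  obtain ⟨ψ, hψ⟩ := exists_ringHom_factor (mapRingHom ι) hιX A.val.toRingHom
    (fun f ↦ hsub f f.2)
  replace hψ : ∀ f : A, (ψ f).map ι = (f : K[X]) := hψ
  have hψinj : Function.Injective ψ := fun f g h ↦ Subtype.ext (by rw [← hψ, ← hψ, h])
  have hψmem (g : V[X]) (hg : ∀ a ∈ E, g.eval (algebraMap D V a) ∈ (algebraMap D V).range) :
      ∃ f : A, ψ f = g := by
    refine ⟨⟨g.map ι, ?_⟩, hιX (hψ _)⟩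
    rintro _ ⟨a, ha, rfl⟩
    obtain ⟨d, hd⟩ := hg a ha
    exact ⟨d, by rw [← hιD, ← hιD, eval_map_apply, hd]⟩
  have hψeval (f : A) (a : D) (ha : a ∈ E) :
      (ψ f).eval (algebraMap D V a) ∈ (algebraMap D V).range := by
    obtain ⟨d, hd⟩ := f.2 _ ⟨a, ha, rfl⟩
    exact ⟨d, hι (by rw [hιD, hd, ← hψ, ← hιD, eval_map_apply])⟩
  -- `V[X]` is a localization of `A`
  let _ : Algebra A V[X] := ψ.toAlgebra
  have hψC (d : D) : ψ (algebraMap D A d) = C (algebraMap D V d) := by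
    apply hιX
    rw [coe_mapRingHom, hψ, map_C, hιD]
    rfl
  have hloc : IsLocalization (M.map (algebraMap D A)) V[X] := by
    refine ⟨⟨?_, ?_, ?_⟩⟩
    · rintro ⟨_, d, hd, rfl⟩
      change IsUnit (ψ (algebraMap D A d))
      rw [hψC]
      exact (IsLocalization.map_units V ⟨d, hd⟩).map C
    · intro g
      -- After clearing denominators the coefficients lie in `D`, hence so do the values on `E`.
      obtain ⟨d, hd, h⟩ := IsLocalization.integerNormalization_spec M g
      obtain ⟨f, hf⟩ := hψmem (d • g) fun a _ ↦ by
        rw [← h, eval_map_apply]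
        exact ⟨_, rfl⟩
      refine ⟨⟨f, ⟨_, d, hd, rfl⟩⟩, ?_⟩
      change g * ψ (algebraMap D A d) = ψ f
      rw [hψC, hf, mul_comm, ← smul_eq_C_mul, algebraMap_smul]
    · intro f g h
      exact ⟨1, by rw [hψinj h]⟩
  -- the residue map
  let B := integerValued R (algebraMap R L '' (π '' E))
  have hΦmem (f : A) : (ψ f).map ρ ∈ B := by
    rintro _ ⟨_, ⟨a, ha, rfl⟩, rfl⟩
    obtain ⟨d, hd⟩ := hψeval f a ha
    exact ⟨π d, by rw [← hρD, ← hρD, eval_map_apply, hd]⟩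
  let Φ : A →+* B := ((mapRingHom ρ).comp ψ).codRestrict B hΦmem
  have hΦsurj : Function.Surjective Φ := by
    rintro ⟨h, hh⟩
    obtain ⟨g, rfl⟩ := Polynomial.map_surjective ρ hρ h
    obtain ⟨f, rfl⟩ := hψmem g fun a ha ↦ hpull _ <| by
      rw [← eval_map_apply, hρD]
      exact hh _ ⟨_, ⟨a, ha, rfl⟩, rfl⟩
    exact ⟨f, rfl⟩
  have hρker : RingHom.ker ρ = IsLocalRing.maximalIdeal V :=
    IsLocalRing.eq_maximalIdeal (RingHom.ker_isMaximal_of_surjective ρ hρ)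
  set m := IsLocalRing.maximalIdeal V with hm
  set N : Ideal V[X] := m.map C with hN
  have hNker : N = RingHom.ker (mapRingHom ρ) := by
    rw [hN, ← hρker, ker_mapRingHom]
  have hNprime : N.IsPrime := Ideal.isPrime_map_C_of_isPrime (P := m)
  have hΦker : RingHom.ker Φ = N.under A := by
    ext f
    rw [hNker, RingHom.mem_ker, Ideal.mem_comap, RingHom.mem_ker, ← Subtype.coe_inj]
    rfl
  have hht : (N.under A).height = N.height := IsLocalization.height_under (M.map (algebraMap D A)) N
  rw [ringKrullDim_eq_height_add_ringKrullDim_quotient (N.under A), hht, ← hΦker,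
    ringKrullDim_eq_of_ringEquiv (RingHom.quotientKerEquivOfSurjective hΦsurj)]
  intro Q hQ hNQ
  have hdisj : Disjoint (M.map (algebraMap D A) : Set A) Q := by
    rw [Set.disjoint_left]
    rintro _ ⟨d, hd, rfl⟩ hdQ
    -- If `d ∈ Q`, each `f` in `N ∩ A` lies in `Q`: `f / d` is still in `N`, its values on `E`
    -- reduce to `0` in `L`, so it is in `A`.
    refine hNQ fun f hf ↦ ?_
    obtain ⟨u, hu⟩ := IsLocalization.map_units V (⟨d, hd⟩ : M)
    have hfN : C (↑u⁻¹ : V) * ψ f ∈ N := N.mul_mem_left _ hf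
    obtain ⟨f', hf'⟩ := hψmem _ fun a _ ↦ hpull ((C (↑u⁻¹ : V) * ψ f).eval (algebraMap D V a)) <| by
      rw [hNker, RingHom.mem_ker, coe_mapRingHom] at hfN
      rw [← eval_map_apply, hfN, eval_zero]
      exact zero_mem _
    have : f = f' * algebraMap D A d := by
      apply hψinj
      rw [map_mul, hf', hψC, ← hu, mul_comm, ← mul_assoc, ← C_mul, Units.mul_inv, C_1, one_mul]
    rw [this]
    exact Q.mul_mem_left _ hdQ
  obtain ⟨Q', hQ', hQQ'⟩ : ∃ Q' : Ideal V[X], Q'.IsPrime ∧ Q'.under A = Q :=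
    ⟨_, IsLocalization.isPrime_of_isPrime_disjoint _ V[X] Q hQ hdisj,
      IsLocalization.under_map_of_isPrime_disjoint _ V[X] hQ hdisj⟩
  rw [← hQQ', IsLocalization.height_under (M.map (algebraMap D A)), hht]
  have hq : (Q'.comap C).IsPrime := Ideal.comap_isPrime C Q'
  -- `Q'` does not contain `m[X]`, so `(Q' ∩ V)[X] < m[X]`; this strict step absorbs the `+ 1`.
  refine (height_le_height_map_C_comap_add_one Q').trans
    (Ideal.height_add_one_le_of_lt_of_isPrime (lt_of_le_of_ne
      (Ideal.map_mono (IsLocalRing.le_maximalIdeal hq.ne_top)) fun he ↦ hNQ ?_))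
  rw [← hQQ']
  refine Ideal.comap_mono ?_
  rw [← he]
  exact Ideal.map_comap_le

/-- A polynomial over `K` with values in `V` at infinitely many points that are pairwise
incongruent modulo the maximal ideal of `V` has coefficients in `V`. -/
lemma exists_map_eq_of_eval_mem_range {V K κ : Type*} [CommRing V] [Field K]
    (ι : V →+* K) (hι : Function.Injective ι) {v : κ → V} [Infinite κ]
    (hv : Pairwise fun i j ↦ IsUnit (v i - v j)) (f : K[X])
    (hf : ∀ i, f.eval (ι (v i)) ∈ ι.range) : ∃ g : V[X], g.map ι = f := by
  classical
  have := ι.domain_nontrivial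
  obtain ⟨s, hs⟩ := Infinite.exists_subset_card_eq κ (f.natDegree + 1)
  have hinj : Function.Injective v := fun i j h ↦ by
    by_contra hij
    exact (hv hij).ne_zero (sub_eq_zero.mpr h)
  have hdeg : f.degree < s.card := by
    rw [hs]
    exact degree_le_natDegree.trans_lt (by exact_mod_cast Nat.lt_succ_self _)
  -- The denominators in Lagrange's formula are units of `V`.
  have key : f ∈ (mapRingHom ι).range := by
    rw [Lagrange.eq_interpolate (s := s) (v := ι ∘ v) (hι.comp hinj).injOn hdeg,
      Lagrange.interpolate_apply]
    refine sum_mem fun i _ ↦ mul_mem ?_ (prod_mem fun j hj ↦ mul_mem ?_ ?_)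
    · obtain ⟨w, hw⟩ := hf i
      exact ⟨C w, by simp [hw]⟩
    · obtain ⟨u, hu⟩ := hv (Finset.ne_of_mem_erase hj).symm
      refine ⟨C ↑u⁻¹, ?_⟩
      rw [coe_mapRingHom, map_C, Function.comp, Function.comp, ← map_sub, ← hu,
        ← map_units_inv ι]
    · exact ⟨X - C (v j), by simp⟩
  exact key

/-- If `p` is divided, an element of `D_p` that is congruent modulo `p D_p` to an element of `D`
belongs to `D`. -/
lemma IsDividedPrime.mem_range_of_sub_mem {D : Type*} [CommRing D] {p : Ideal D} [p.IsPrime]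
    (h : IsDividedPrime p) {v : Localization.AtPrime p} {d : D}
    (hv : v - algebraMap D _ d ∈ IsLocalRing.maximalIdeal (Localization.AtPrime p)) :
    v ∈ (algebraMap D (Localization.AtPrime p)).range := by
  rw [← Localization.AtPrime.map_eq_maximalIdeal, ← SetLike.mem_coe, ← h] at hv
  obtain ⟨x, -, hx⟩ := hv
  exact ⟨x + d, by rw [map_add, hx, sub_add_cancel]⟩

/-- A finite domain is a field, so a finite `D / p` would be the whole residue field. -/
lemma infinite_quotient_of_infinite_residueField {D : Type*} [CommRing D] {p : Ideal D} [p.IsPrime]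
    (hinf : Infinite p.ResidueField) : Infinite (D ⧸ p) := by
  by_contra h
  rw [not_infinite_iff_finite] at h
  have : p.IsMaximal := Ideal.Quotient.maximal_of_isField p (Finite.isField_of_domain (D ⧸ p))
  exact hinf.not_finite (.of_surjective _ p.bijective_algebraMap_quotient_residueField.surjective)

/-- An ideal not contained in `p` meets infinitely many cosets of `p` if `D / p` is infinite. -/
lemma infinite_residues_of_not_le {D : Type*} [CommRing D] {p I : Ideal D} [p.IsPrime]
    [Infinite (D ⧸ p)] (h : ¬ I ≤ p) : (residues p (I : Set D)).Infinite := by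
  obtain ⟨x, hxI, hxp⟩ := Set.not_subset.mp h
  have hx : Ideal.Quotient.mk p x ≠ 0 := fun h0 ↦ hxp (Ideal.Quotient.eq_zero_iff_mem.mp h0)
  refine Set.infinite_of_injective_forall_mem (mul_left_injective₀ hx) fun d ↦ ?_
  obtain ⟨d, rfl⟩ := Ideal.Quotient.mk_surjective d
  exact ⟨d * x, I.mul_mem_left d hxI, map_mul _ _ _⟩

theorem theorem1 {D K L : Type*} [CommRing D] [IsDomain D]
    [Field K] [Algebra D K] [IsFractionRing D K]
    (p : Ideal D) [p.IsPrime] (hdiv : IsDividedPrime p) (hinf : Infinite p.ResidueField)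
    [Field L] [Algebra (D ⧸ p) L] [IsFractionRing (D ⧸ p) L]
    (E : Set D) (hne : E.Nonempty)
    (hE : (residues p E).Infinite ∨
      (∃ I : Ideal D, (I : Set D) = E ∧ p ≤ I ∧ (p ≠ ⊥ → I ≠ p)) ∨
      IsResiduallyCofinite E) :
    ringKrullDim (integerValued D (algebraMap D K '' E)) + 1 =
        ringKrullDim (Localization.AtPrime p)[X] +
          ringKrullDim (integerValued (D ⧸ p) (algebraMap (D ⧸ p) L '' residues p E)) ∧
      (p.IsMaximal →
        ringKrullDim (integerValued D (algebraMap D K '' E)) =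
            ringKrullDim (Localization.AtPrime p)[X] ∧
          ringKrullDim (integerValued D (algebraMap D K '' E)) ≤ ringKrullDim D[X]) := by
  let V := Localization.AtPrime p
  have hunitK (y : p.primeCompl) : IsUnit (algebraMap D K y) := by
    rw [isUnit_iff_ne_zero, Ne, IsFractionRing.to_map_eq_zero_iff]
    exact fun h ↦ y.2 (h ▸ p.zero_mem)
  let ι : V →+* K := IsLocalization.lift hunitK
  have hιD (d : D) : ι (algebraMap D V d) = algebraMap D K d := IsLocalization.lift_eq hunitK d
  have hι : Function.Injective ι :=
    (IsLocalization.lift_injective_iff hunitK).mpr fun x y ↦ by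
      rw [(IsLocalization.injective V p.primeCompl_le_nonZeroDivisors).eq_iff,
        (IsFractionRing.injective D K).eq_iff]
  have hunitL (y : p.primeCompl) :
      IsUnit (((algebraMap (D ⧸ p) L).comp (Ideal.Quotient.mk p)) y) := by
    rw [isUnit_iff_ne_zero, RingHom.comp_apply, Ne, IsFractionRing.to_map_eq_zero_iff,
      Ideal.Quotient.eq_zero_iff_mem]
    exact y.2
  let ρ : V →+* L := IsLocalization.lift hunitL
  have hρD (d : D) : ρ (algebraMap D V d) = algebraMap (D ⧸ p) L (Ideal.Quotient.mk p d) :=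
    IsLocalization.lift_eq hunitL d
  have hρ : Function.Surjective ρ := by
    intro x
    obtain ⟨a, b, hb, rfl⟩ := IsFractionRing.div_surjective (A := D ⧸ p) x
    obtain ⟨a, rfl⟩ := Ideal.Quotient.mk_surjective a
    obtain ⟨b, rfl⟩ := Ideal.Quotient.mk_surjective b
    have hbp : b ∈ p.primeCompl := fun h ↦
      nonZeroDivisors.ne_zero hb (Ideal.Quotient.eq_zero_iff_mem.mpr h)
    refine ⟨IsLocalization.mk' V a ⟨b, hbp⟩, ?_⟩
    rw [eq_div_iff (IsFractionRing.to_map_ne_zero_of_mem_nonZeroDivisors hb), ← hρD, ← hρD,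
      ← map_mul]
    exact congrArg ρ (IsLocalization.mk'_spec V a ⟨b, hbp⟩)
  have hρker : RingHom.ker ρ = IsLocalRing.maximalIdeal V :=
    IsLocalRing.eq_maximalIdeal (RingHom.ker_isMaximal_of_surjective ρ hρ)
  have hpull (v : V) (hv : ρ v ∈ (algebraMap (D ⧸ p) L).range) : v ∈ (algebraMap D V).range := by
    obtain ⟨d, hd⟩ := hv
    obtain ⟨d, rfl⟩ := Ideal.Quotient.mk_surjective d
    refine hdiv.mem_range_of_sub_mem (d := d) ?_
    rw [← hρker, RingHom.mem_ker, map_sub, hρD, hd, sub_self]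
  have := infinite_quotient_of_infinite_residueField hinf
  have hcases : (residues p E).Infinite ∨ p = ⊥ := by
    rcases hE with h | ⟨I, rfl, hpI, hI⟩ | h
    · exact .inl h
    · by_cases hp : p = ⊥
      · exact .inr hp
      · exact .inl (infinite_residues_of_not_le fun h ↦ hI hp (le_antisymm h hpI))
    · exact .inl fun hfin ↦ not_finite_iff_infinite.mpr ‹_› (h p inferInstance hfin)
  have hsub (f : K[X]) (hf : f ∈ integerValued D (algebraMap D K '' E)) :
      ∃ g : V[X], g.map ι = f := by
    rcases hcases with h | rfl
    · have := h.to_subtype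
      choose e heE he using fun r : residues p E ↦ r.2
      refine exists_map_eq_of_eval_mem_range ι hι (v := fun r ↦ algebraMap D V (e r))
        (fun r s hrs ↦ ?_) f fun r ↦ ?_
      · beta_reduce
        rw [← map_sub]
        refine IsLocalization.map_units V (⟨e r - e s, fun hmem ↦ hrs (Subtype.ext ?_)⟩ :
          p.primeCompl)
        rw [← he, ← he]
        exact Ideal.Quotient.eq.mpr hmem
      · obtain ⟨d, hd⟩ := hf _ ⟨e r, heE r, rfl⟩
        exact ⟨algebraMap D V d, by rw [hιD, hιD, hd]⟩
    · refine Polynomial.map_surjective ι (fun x ↦ ?_) f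
      obtain ⟨a, b, hb, rfl⟩ := IsFractionRing.div_surjective (A := D) x
      have hbp : b ∈ (⊥ : Ideal D).primeCompl := nonZeroDivisors.ne_zero hb
      refine ⟨IsLocalization.mk' V a ⟨b, hbp⟩, ?_⟩
      rw [eq_div_iff (IsFractionRing.to_map_ne_zero_of_mem_nonZeroDivisors hb), ← hιD, ← hιD,
        ← map_mul]
      exact congrArg ι (IsLocalization.mk'_spec V a ⟨b, hbp⟩)
  have hdim : ringKrullDim (integerValued D (algebraMap D K '' E)) =
      ((IsLocalRing.maximalIdeal V).map C : Ideal V[X]).height +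
        ringKrullDim (integerValued (D ⧸ p) (algebraMap (D ⧸ p) L '' residues p E)) :=
    ringKrullDim_integerValued_of_pullback p.primeCompl ι hι hιD (Ideal.Quotient.mk p) ρ hρ hρD
      hpull E hsub
  have hV : ringKrullDim V[X] = ((IsLocalRing.maximalIdeal V).map C : Ideal V[X]).height + 1 :=
    ringKrullDim_polynomial_of_isLocalRing
  refine ⟨?_, fun hp ↦ ?_⟩
  · rw [hdim, hV, add_right_comm]
  -- Here `D / p = L`, so the residual ring is `L[X]`, of dimension one.
  · have heq : ringKrullDim (integerValued D (algebraMap D K '' E)) = ringKrullDim V[X] := by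
      let _ := Ideal.Quotient.field p
      have hsurj : Function.Surjective (algebraMap (D ⧸ p) L) := fun x ↦ by
        obtain ⟨a, b, -, rfl⟩ := IsFractionRing.div_surjective (A := D ⧸ p) x
        exact ⟨a / b, map_div₀ _ a b⟩
      have htop : integerValued (D ⧸ p) (algebraMap (D ⧸ p) L '' residues p E) = ⊤ :=
        eq_top_iff.mpr fun f _ a _ ↦ hsurj _
      rw [hdim, hV, htop, ringKrullDim_eq_of_ringEquiv
        (Subalgebra.topEquiv (R := D ⧸ p) (A := L[X])).toRingEquiv]
      rw [Polynomial.ringKrullDim_of_isNoetherianRing, ringKrullDim_eq_zero_of_field, zero_add]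
    refine ⟨heq, heq ▸ ?_⟩
    let _ : Algebra D[X] V[X] := Polynomial.algebra ..
    have := Polynomial.isLocalization p.primeCompl V
    exact ringKrullDim_le_of_isLocalization (p.primeCompl.map C) V[X]
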